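/- Conventions. A weight structure on a triangulated category $\mathcal T$ is a pair $w=(\mathcal T^{w\le 0},\mathcal T^{w\ge 0})$ of full subcategories such that, with $\mathcal T^{w\le n}:=[-n]\mathcal T^{w\le 0}$ and $\mathcal T^{w\ge n}:=[-n]\mathcal T^{w\ge 0}$: (i) both are additive and closed under retracts in $\mathcal T$; (ii) $\mathcal T^{w\le 0}\subset\mathcal T^{w\le 1}$ and $\mathcal T^{w\ge 1}\subset\mathcal T^{w\ge 0}$; (iii) $\operatorname{Hom}(\mathcal T^{w\ge 1},\mathcal T^{w\le 0})=0$; (iv) every $X\in\mathcal T$ fits into a distinguished triangle $A\to X\to B\to[1]A$ with $A\in\mathcal T^{w\ge 1}$ and $B\in\mathcal T^{w\le 0}$. An f-category is a triangulated category $\tilde{\mathcal T}$ with strict full triangulated subcategories $\tilde{\mathcal T}(\le 0)$, $\tilde{\mathcal T}(\ge 0)$, a triangulated autoequivalence $s$ of $\tilde{\mathcal T}$ and a morphism $\alpha:\mathrm{id}\to s$ of triangulated functors such that, with $\tilde{\mathcal T}(\le n):=s^n(\tilde{\mathcal T}(\le 0))$ and $\tilde{\mathcal T}(\ge n):=s^n(\tilde{\mathcal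 T}(\ge 0))$ (closed under isomorphism) for $n\in\mathbb Z$: (1) $\tilde{\mathcal T}(\ge 1)\subset\tilde{\mathcal T}(\ge 0)$ and $\tilde{\mathcal T}(\le 0)\subset\tilde{\mathcal T}(\le 1)$; (2) $\tilde{\mathcal T}=\bigcup_n\tilde{\mathcal T}(\le n)=\bigcup_n\tilde{\mathcal T}(\ge n)$; (3) $\operatorname{Hom}(\tilde{\mathcal T}(\ge 1),\tilde{\mathcal T}(\le 0))=0$; (4) every $X$ fits into a distinguished triangle $A\to X\to B\to[1]A$ with $A\in\tilde{\mathcal T}(\ge 1)$ and $B\in\tilde{\mathcal T}(\le 0)$; (5) $\alpha_{s(X)}=s(\alpha_X)$ for all $X$; (6) for $X\in\tilde{\mathcal T}(\le 0)$ and $Y\in\tilde{\mathcal T}(\ge 1)$ the map $\operatorname{Hom}(X,s^{-1}Y)\to\operatorname{Hom}(X,Y)$, $f\mapsto\alpha_{s^{-1}Y}\circ f$ (identifying $s(s^{-1}Y)$ with $Y$), is bijective. An f-category over a triangulated category $\mathcal T$ is an f-category $\tilde{\mathcal T}$ together with an equivalence $i:\mathcal T\to\tilde{\mathcal T}(\le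 0)\cap\tilde{\mathcal T}(\ge 0)$ of triangulated categories. The inclusion of $\tilde{\mathcal T}(\ge n)$ in $\tilde{\mathcal T}$ has a right adjoint $\sigma_{\ge n}$, and the inclusion of $\tilde{\mathcal T}(\le n)$ has a left adjoint $\sigma_{\le n}$. Put $\sigma_n:=\sigma_{\le n}\sigma_{\ge n}$ and $\operatorname{gr}^n:=i^{-1}s^{-n}\sigma_n:\tilde{\mathcal T}\to\mathcal T$, where $i^{-1}$ is a quasi-inverse of $i$. Proposition. Let $(\tilde{\mathcal T},i)$ be an f-category over a triangulated category $\mathcal T$ and let $w$ be a weight structure on $\mathcal T$. There is a unique weight structure $\tilde w=(\tilde{\mathcal T}^{w\le 0},\tilde{\mathcal T}^{w\ge 0})$ on $\tilde{\mathcal T}$ that is compatible with $w$, i.e. such that $i:\mathcal T\to\tilde{\mathcal T}$ is w-exact ($i(\mathcal T^{w\le 0})\subset\tilde{\mathcal T}^{w\le 0}$ and $i(\mathcal T^{w\ge 0})\subset\tilde{\mathcal T}^{w\ge 0}$) and $s(\tilde{\mathcal T}^{w\le 0})=\tilde{\mathcal T}^{w\le 1}$. It is given by $$\tilde{\mathcal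 T}^{w\le 0}=\{X\in\tilde{\mathcal T}\mid \operatorname{gr}^j(X)\in\mathcal T^{w\le -j}\text{ for all }j\in\mathbb Z\},\qquad \tilde{\mathcal T}^{w\ge 0}=\{X\in\tilde{\mathcal T}\mid \operatorname{gr}^j(X)\in\mathcal T^{w\ge -j}\text{ for all }j\in\mathbb Z\}.$$ -/

import Mathlib

open CategoryTheory CategoryTheory.Limits CategoryTheory.Pretriangulated

universe v₁ v₂ u₁ u₂

/-! ### Weight structures -/

/-- A weight structure `(C^{w ≤ 0}, C^{w ≥ 0})` on a triangulated category. Full subcategories are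
encoded as properties of objects. With `C^{w ≤ n} := [-n] C^{w ≤ 0}`, an object `X` lies in
`C^{w ≤ n}` iff `X⟦n⟧` lies in `C^{w ≤ 0}`, i.e. iff `le.shift n X`. -/
@[ext]
structure WeightStructure (C : Type u₁) [Category.{v₁} C] [Preadditive C] [HasZeroObject C]
    [HasShift C ℤ] [∀ n : ℤ, (shiftFunctor C n).Additive] [Pretriangulated C] where
  /-- the subcategory `C^{w ≤ 0}` -/
  le : ObjectProperty C
  /-- the subcategory `C^{w ≥ 0}` -/
  ge : ObjectProperty C
  le_containsZero : le.ContainsZero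
  le_closedUnderBinaryProducts : le.IsClosedUnderBinaryProducts
  le_stableUnderRetracts : le.IsStableUnderRetracts
  ge_containsZero : ge.ContainsZero
  ge_closedUnderBinaryProducts : ge.IsClosedUnderBinaryProducts
  ge_stableUnderRetracts : ge.IsStableUnderRetracts
  le_zero_le_one : le ≤ le.shift (1 : ℤ)
  ge_one_le_zero : ge.shift (1 : ℤ) ≤ ge
  hom_eq_zero : ∀ ⦃X Y : C⦄ (f : X ⟶ Y), ge.shift (1 : ℤ) X → le Y → f = 0
  exists_triangle : ∀ X : C, ∃ (A B : C) (f : A ⟶ X) (g : X ⟶ B) (h : B ⟶ A⟦(1 : ℤ)⟧),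
    Triangle.mk f g h ∈ distTriang C ∧ ge.shift (1 : ℤ) A ∧ le B

namespace WeightStructure

variable {C : Type u₁} [Category.{v₁} C] [Preadditive C] [HasZeroObject C]
  [HasShift C ℤ] [∀ n : ℤ, (shiftFunctor C n).Additive] [Pretriangulated C]

/-- The subcategory `C^{w ≤ n} = [-n] C^{w ≤ 0}`. -/
def leN (w : WeightStructure C) (n : ℤ) : ObjectProperty C := w.le.shift n

/-- The subcategory `C^{w ≥ n} = [-n] C^{w ≥ 0}`. -/
def geN (w : WeightStructure C) (n : ℤ) : ObjectProperty C := w.ge.shift n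

end WeightStructure

/-- A triangulated functor is w-exact if it preserves both halves of the weight structures. -/
def WExact {C : Type u₁} [Category.{v₁} C] [Preadditive C] [HasZeroObject C]
    [HasShift C ℤ] [∀ n : ℤ, (shiftFunctor C n).Additive] [Pretriangulated C]
    {D : Type u₂} [Category.{v₂} D] [Preadditive D] [HasZeroObject D]
    [HasShift D ℤ] [∀ n : ℤ, (shiftFunctor D n).Additive] [Pretriangulated D]
    (w : WeightStructure C) (w' : WeightStructure D)
    (F : C ⥤ D) [F.CommShift ℤ] [F.IsTriangulated] : Prop :=
  (∀ X, w.le X → w'.le (F.obj X)) ∧ (∀ X, w.ge X → w'.ge (F.obj X))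

/-! ### Filtered triangulated categories -/

/-- `s^n(P)` for an autoequivalence `s` and a full subcategory `P` (the essential image of `P` under
the functor `s^n`, where `s^n` for negative `n` is a power of the inverse of `s`). -/
def powImage {C : Type u₁} [Category.{v₁} C] (s : C ≌ C) (P : ObjectProperty C) (n : ℤ) :
    ObjectProperty C :=
  P.map (s ^ n).functor

/-- The structure of a filtered triangulated category (f-category) on a triangulated category `C`:
strict full triangulated subcategories `C(≤ 0)` and `C(≥ 0)`, a triangulated autoequivalence `s`
(the shift of filtration), and a morphism `α : id ⟶ s` of triangulated functors, where
`C(≤ n) := s^n(C(≤ 0))` and `C(≥ n) := s^n(C(≥ 0))`. -/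
structure FCategory (C : Type u₁) [Category.{v₁} C] [Preadditive C] [HasZeroObject C]
    [HasShift C ℤ] [∀ n : ℤ, (shiftFunctor C n).Additive] [Pretriangulated C] where
  /-- the subcategory `C(≤ 0)` -/
  le : ObjectProperty C
  /-- the subcategory `C(≥ 0)` -/
  ge : ObjectProperty C
  le_isTriangulated : le.IsTriangulated
  le_isClosedUnderIso : le.IsClosedUnderIsomorphisms
  ge_isTriangulated : ge.IsTriangulated
  ge_isClosedUnderIso : ge.IsClosedUnderIsomorphisms
  /-- the shift of filtration -/
  s : C ≌ C
  sCommShift : s.functor.CommShift ℤ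
  s_isTriangulated : s.functor.IsTriangulated
  /-- the morphism `id ⟶ s` -/
  α : 𝟭 C ⟶ s.functor
  α_commShift : NatTrans.CommShift α ℤ
  ge_one_le : powImage s ge 1 ≤ ge
  le_le_one : le ≤ powImage s le 1
  exists_le : ∀ X : C, ∃ n : ℤ, powImage s le n X
  exists_ge : ∀ X : C, ∃ n : ℤ, powImage s ge n X
  hom_eq_zero : ∀ ⦃X Y : C⦄ (f : X ⟶ Y), powImage s ge 1 X → le Y → f = 0
  exists_triangle : ∀ X : C, ∃ (A B : C) (f : A ⟶ X) (g : X ⟶ B) (h : B ⟶ A⟦(1 : ℤ)⟧),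
    Triangle.mk f g h ∈ distTriang C ∧ powImage s ge 1 A ∧ le B
  α_app_s : ∀ X : C, α.app (s.functor.obj X) = s.functor.map (α.app X)
  -- Composition with `α` at `s⁻¹ Y` is a bijection from `Hom(X, s⁻¹ Y)` to `Hom(X, Y)`, where
  -- `s (s⁻¹ Y)` is identified with `Y` through the counit.
  bijective_comp_α : ∀ ⦃X Y : C⦄, le X → powImage s ge 1 Y →
    Function.Bijective (fun f : X ⟶ s.inverse.obj Y =>
      (f ≫ α.app (s.inverse.obj Y) ≫ s.counitIso.hom.app Y : X ⟶ Y))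

namespace FCategory

attribute [instance] le_isTriangulated le_isClosedUnderIso ge_isTriangulated ge_isClosedUnderIso
  sCommShift s_isTriangulated α_commShift

variable {C : Type u₁} [Category.{v₁} C] [Preadditive C] [HasZeroObject C]
  [HasShift C ℤ] [∀ n : ℤ, (shiftFunctor C n).Additive] [Pretriangulated C]

/-- The subcategory `C(≤ n) = s^n(C(≤ 0))`. -/
def leN (F : FCategory C) (n : ℤ) : ObjectProperty C := powImage F.s F.le n

/-- The subcategory `C(≥ n) = s^n(C(≥ 0))`. -/
def geN (F : FCategory C) (n : ℤ) : ObjectProperty C := powImage F.s F.ge n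

/-- The subcategory `C([0]) = C(≤ 0) ∩ C(≥ 0)`. -/
abbrev core (F : FCategory C) : ObjectProperty C := F.le ⊓ F.ge

/-! Helper facts: existence of the adjoints to the inclusions. -/

lemma powNat_isTriangulated (e : C ≌ C)
    (h : ∃ _ : e.functor.CommShift ℤ, e.functor.IsTriangulated) (n : ℕ) :
    ∃ _ : (e.powNat n).functor.CommShift ℤ, (e.powNat n).functor.IsTriangulated := by
  induction n with
  | zero => exact ⟨inferInstanceAs ((𝟭 C).CommShift ℤ), inferInstanceAs ((𝟭 C).IsTriangulated)⟩
  | succ n ih =>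
    cases n with
    | zero => exact h
    | succ n =>
      obtain ⟨_, _⟩ := h
      obtain ⟨_, _⟩ := ih
      exact ⟨inferInstanceAs ((e.functor ⋙ (e.powNat (n + 1)).functor).CommShift ℤ),
        inferInstanceAs ((e.functor ⋙ (e.powNat (n + 1)).functor).IsTriangulated)⟩

lemma pow_isTriangulated (F : FCategory C) (n : ℤ) :
    ∃ _ : (F.s ^ n).functor.CommShift ℤ, (F.s ^ n).functor.IsTriangulated := by
  cases n with
  | ofNat n => exact powNat_isTriangulated F.s ⟨inferInstance, inferInstance⟩ n
  | negSucc n =>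
    refine powNat_isTriangulated F.s.symm ?_ (n + 1)
    let c : F.s.inverse.CommShift ℤ := F.s.commShiftInverse ℤ
    have := F.s.commShift_of_functor ℤ
    have : F.s.IsTriangulated := Equivalence.IsTriangulated.mk' F.s inferInstance
    exact ⟨c, (inferInstance : F.s.inverse.IsTriangulated)⟩

instance (F : FCategory C) (n : ℤ) : (F.leN n).IsClosedUnderIsomorphisms := by
  unfold leN powImage; infer_instance

instance (F : FCategory C) (n : ℤ) : (F.geN n).IsClosedUnderIsomorphisms := by
  unfold geN powImage; infer_instance

lemma map_isTriangulated (F : FCategory C) (P : ObjectProperty C) [P.IsTriangulated] (n : ℤ) :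
    (powImage F.s P n).IsTriangulated := by
  obtain ⟨_, _⟩ := F.pow_isTriangulated n
  have h : powImage F.s P n = P.map (F.s ^ n).functor := rfl
  have h2 : P.map (F.s ^ n).functor = (P.ι ⋙ (F.s ^ n).functor).essImage := by
    ext Y
    constructor
    · rintro ⟨X, hX, ⟨e⟩⟩
      exact ⟨⟨X, hX⟩, ⟨e⟩⟩
    · rintro ⟨X, ⟨e⟩⟩
      exact ⟨X.1, X.2, ⟨e⟩⟩
  rw [h, h2]
  infer_instance

instance (F : FCategory C) (n : ℤ) : (F.leN n).IsTriangulated := F.map_isTriangulated F.le n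

instance (F : FCategory C) (n : ℤ) : (F.geN n).IsTriangulated := F.map_isTriangulated F.ge n

lemma powIso {C : Type u₁} [Category.{v₁} C] (e : C ≌ C) (n : ℤ) :
    Nonempty ((e ^ (n + 1)).functor ≅ e.functor ⋙ (e ^ n).functor) := by
  match n with
  | Int.ofNat 0 => exact ⟨(Functor.rightUnitor _).symm⟩
  | Int.ofNat (k + 1) => exact ⟨Iso.refl _⟩
  | Int.negSucc 0 => exact ⟨e.unitIso⟩
  | Int.negSucc (k + 1) =>
    exact ⟨(Functor.leftUnitor _).symm ≪≫
      Functor.isoWhiskerRight e.unitIso (e.symm.powNat (k + 1)).functor ≪≫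
      Functor.associator _ _ _⟩

lemma powImage_succ {C : Type u₁} [Category.{v₁} C] (e : C ≌ C) (P : ObjectProperty C) (n : ℤ) :
    powImage e P (n + 1) = powImage e (powImage e P 1) n := by
  obtain ⟨i⟩ := powIso e n
  ext Y
  constructor
  · rintro ⟨X, hX, ⟨f⟩⟩
    exact ⟨e.functor.obj X, ⟨X, hX, ⟨Iso.refl _⟩⟩, ⟨(i.app X).symm ≪≫ f⟩⟩
  · rintro ⟨X, ⟨Z, hZ, ⟨g⟩⟩, ⟨f⟩⟩
    exact ⟨Z, hZ, ⟨i.app Z ≪≫ (e ^ n).functor.mapIso g ≪≫ f⟩⟩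

lemma geN_succ_le (F : FCategory C) (n : ℤ) : F.geN (n + 1) ≤ F.geN n := by
  unfold geN
  rw [powImage_succ]
  exact ObjectProperty.map_monotone F.ge_one_le _

lemma homN_eq_zero (F : FCategory C) (n : ℤ) {X Y : C} (f : X ⟶ Y) (hX : F.geN (n + 1) X)
    (hY : F.leN n Y) : f = 0 := by
  unfold geN at hX
  rw [powImage_succ] at hX
  obtain ⟨X', hX', ⟨a⟩⟩ := hX
  obtain ⟨Y', hY', ⟨b⟩⟩ := hY
  obtain ⟨g, hg⟩ := (F.s ^ n).functor.map_surjective (a.hom ≫ f ≫ b.inv)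
  have hg0 : g = 0 := F.hom_eq_zero g hX' hY'
  have h1 : a.hom ≫ f ≫ b.inv = 0 := by
    rw [← hg, hg0, Functor.map_zero]
  have h2 : f = a.inv ≫ (a.hom ≫ f ≫ b.inv) ≫ b.hom := by simp
  rw [h2, h1]
  simp

lemma exists_triangleN (F : FCategory C) (n : ℤ) (X : C) :
    ∃ (A B : C) (f : A ⟶ X) (g : X ⟶ B) (h : B ⟶ A⟦(1 : ℤ)⟧),
      Triangle.mk f g h ∈ distTriang C ∧ F.geN (n + 1) A ∧ F.leN n B := by
  obtain ⟨_, _⟩ := F.pow_isTriangulated n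
  obtain ⟨A, B, f, g, h, hT, hA, hB⟩ := F.exists_triangle ((F.s ^ n).inverse.obj X)
  let e : (F.s ^ n).functor.obj ((F.s ^ n).inverse.obj X) ≅ X := (F.s ^ n).counitIso.app X
  refine ⟨(F.s ^ n).functor.obj A, (F.s ^ n).functor.obj B, (F.s ^ n).functor.map f ≫ e.hom,
    e.inv ≫ (F.s ^ n).functor.map g,
    (F.s ^ n).functor.map h ≫ ((F.s ^ n).functor.commShiftIso (1 : ℤ)).hom.app A, ?_, ?_, ?_⟩
  · refine isomorphic_distinguished _ ((F.s ^ n).functor.map_distinguished _ hT) _ ?_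
    refine Triangle.isoMk _ _ (Iso.refl _) e.symm (Iso.refl _) ?_ ?_ ?_
    · change ((F.s ^ n).functor.map f ≫ e.hom) ≫ e.inv = 𝟙 _ ≫ (F.s ^ n).functor.map f
      rw [Category.assoc, e.hom_inv_id, Category.comp_id, Category.id_comp]
    · change (e.inv ≫ (F.s ^ n).functor.map g) ≫ 𝟙 _ = e.inv ≫ (F.s ^ n).functor.map g
      rw [Category.comp_id]
    · let c := (F.s ^ n).functor.map h ≫ ((F.s ^ n).functor.commShiftIso (1 : ℤ)).hom.app A
      change c ≫ (shiftFunctor C (1 : ℤ)).map (𝟙 ((F.s ^ n).functor.obj A)) = 𝟙 _ ≫ c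
      rw [Category.id_comp]
      exact (congrArg (c ≫ ·) ((shiftFunctor C (1 : ℤ)).map_id ((F.s ^ n).functor.obj A))).trans
        (Category.comp_id c)
  · unfold geN
    rw [powImage_succ]
    exact ⟨A, hA, ⟨Iso.refl _⟩⟩
  · exact ⟨B, hB, ⟨Iso.refl _⟩⟩

/-- The inclusion of `C(≥ n)` has a right adjoint. -/
instance geN_ι_isLeftAdjoint (F : FCategory C) (n : ℤ) : (F.geN n).ι.IsLeftAdjoint := by
  rw [isLeftAdjoint_iff_hasTerminal_costructuredArrow]
  intro X
  obtain ⟨A, B, f, g, h, hT, hA, hB⟩ := F.exists_triangleN (n - 1) X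
  rw [sub_add_cancel] at hA
  have hz : ∀ {W Z : C} (k : W ⟶ Z), F.geN n W → F.leN (n - 1) Z → k = 0 := by
    intro W Z k hW hZ
    exact F.homN_eq_zero (n - 1) k (by rwa [sub_add_cancel]) hZ
  have ex : ∀ W : CostructuredArrow (F.geN n).ι X, ∃ k : W.left.obj ⟶ A, k ≫ f = W.hom := by
    intro W
    obtain ⟨k, hk⟩ := Triangle.coyoneda_exact₂ _ hT W.hom (hz _ W.left.property hB)
    exact ⟨k, hk.symm⟩
  have inj : ∀ {W : C} (_ : F.geN n W) (k k' : W ⟶ A), k ≫ f = k' ≫ f → k = k' := by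
    intro W hW k k' hk
    obtain ⟨l, hl⟩ := Triangle.coyoneda_exact₂ _ (inv_rot_of_distTriang _ hT) (k - k')
      (by
        change (k - k') ≫ f = 0
        rw [Preadditive.sub_comp, hk, sub_self])
    have : l = 0 := hz l hW ((F.leN (n - 1)).le_shift (-1 : ℤ) _ hB)
    rw [this, zero_comp] at hl
    exact sub_eq_zero.1 hl
  let t : CostructuredArrow (F.geN n).ι X :=
    CostructuredArrow.mk (Y := (⟨A, hA⟩ : (F.geN n).FullSubcategory)) (S := (F.geN n).ι) f
  refine IsTerminal.hasTerminal (X := t) (IsTerminal.ofUniqueHom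
    (fun W => CostructuredArrow.homMk (ObjectProperty.homMk (ex W).choose) (ex W).choose_spec) ?_)
  intro W m
  apply CostructuredArrow.hom_ext
  apply (F.geN n).ι.map_injective
  apply inj W.left.property
  exact (CostructuredArrow.w m).trans (ex W).choose_spec.symm

/-- The inclusion of `C(≤ n)` has a left adjoint. -/
instance leN_ι_isRightAdjoint (F : FCategory C) (n : ℤ) : (F.leN n).ι.IsRightAdjoint := by
  rw [isRightAdjoint_iff_hasInitial_structuredArrow]
  intro X
  obtain ⟨A, B, f, g, h, hT, hA, hB⟩ := F.exists_triangleN n X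
  have ex : ∀ W : StructuredArrow X (F.leN n).ι, ∃ k : B ⟶ W.right.obj, g ≫ k = W.hom := by
    intro W
    obtain ⟨k, hk⟩ := Triangle.yoneda_exact₂ _ hT W.hom
      (F.homN_eq_zero n _ hA W.right.property)
    exact ⟨k, hk.symm⟩
  have inj : ∀ {W : C} (_ : F.leN n W) (k k' : B ⟶ W), g ≫ k = g ≫ k' → k = k' := by
    intro W hW k k' hk
    obtain ⟨l, hl⟩ := Triangle.yoneda_exact₃ _ hT (k - k') (by
      change g ≫ (k - k') = 0
      rw [Preadditive.comp_sub, hk, sub_self])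
    have : l = 0 := F.homN_eq_zero n l ((F.geN (n + 1)).le_shift (1 : ℤ) _ hA) hW
    rw [this, comp_zero] at hl
    exact sub_eq_zero.1 hl
  let t : StructuredArrow X (F.leN n).ι :=
    StructuredArrow.mk (Y := (⟨B, hB⟩ : (F.leN n).FullSubcategory)) (T := (F.leN n).ι) g
  refine IsInitial.hasInitial (X := t) (IsInitial.ofUniqueHom
    (fun W => StructuredArrow.homMk (ObjectProperty.homMk (ex W).choose) (ex W).choose_spec) ?_)
  intro W m
  apply StructuredArrow.hom_ext
  apply (F.leN n).ι.map_injective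
  apply inj W.right.property
  exact (StructuredArrow.w m).trans (ex W).choose_spec.symm

/-! ### Truncations and graded pieces -/

/-- The truncation `σ_{≥ n}`, a right adjoint of the inclusion of `C(≥ n)`. -/
noncomputable def σGE (F : FCategory C) (n : ℤ) : C ⥤ (F.geN n).FullSubcategory :=
  (F.geN n).ι.rightAdjoint

/-- The truncation `σ_{≤ n}`, a left adjoint of the inclusion of `C(≤ n)`. -/
noncomputable def σLE (F : FCategory C) (n : ℤ) : C ⥤ (F.leN n).FullSubcategory :=
  (F.leN n).ι.leftAdjoint

/-- The fixed adjunction between the inclusion of `C(≥ n)` and `σ_{≥ n}`. -/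
noncomputable def σGEAdj (F : FCategory C) (n : ℤ) : (F.geN n).ι ⊣ F.σGE n :=
  Adjunction.ofIsLeftAdjoint _

/-- The fixed adjunction between `σ_{≤ n}` and the inclusion of `C(≤ n)`. -/
noncomputable def σLEAdj (F : FCategory C) (n : ℤ) : F.σLE n ⊣ (F.leN n).ι :=
  Adjunction.ofIsRightAdjoint _

/-- The functor `σ_n = σ_{≤ n} σ_{≥ n}`, as an endofunctor of `C`. -/
noncomputable def σ (F : FCategory C) (n : ℤ) : C ⥤ C :=
  (F.σGE n ⋙ (F.geN n).ι) ⋙ (F.σLE n ⋙ (F.leN n).ι)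

lemma leN_σ (F : FCategory C) (n : ℤ) (X : C) : F.leN n ((F.σ n).obj X) :=
  ((F.σLE n).obj _).property

lemma geN_σ (F : FCategory C) (n : ℤ) (X : C) : F.geN n ((F.σ n).obj X) := by
  have key : ∀ Y : C, F.geN n Y → F.geN n ((F.σLE n).obj Y).obj := by
    intro Y hY
    obtain ⟨A, B, f, g, h, hT, hA, hB⟩ := F.exists_triangleN n Y
    have hB' : F.geN n B :=
      (F.geN n).ext_of_isTriangulatedClosed₃ _ hT (F.geN_succ_le n _ hA) hY
    -- The truncation of `Y` and `B` are both initial among maps from `Y` to `C(≤ n)`.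
    let adj := F.σLEAdj n
    let B₀ : (F.leN n).FullSubcategory := ⟨B, hB⟩
    let u : Y ⟶ ((F.σLE n).obj Y).obj := adj.unit.app Y
    have exk : ∃ k : B ⟶ ((F.σLE n).obj Y).obj, u = g ≫ k :=
      Triangle.yoneda_exact₂ _ hT u (F.homN_eq_zero n _ hA ((F.σLE n).obj Y).property)
    obtain ⟨k, hk⟩ := exk
    let k' : B₀ ⟶ (F.σLE n).obj Y := ObjectProperty.homMk k
    have hk' : (F.leN n).ι.map k' = k := rfl
    obtain ⟨l, hl⟩ := (adj.homEquiv Y B₀).surjective g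
    have hl' : u ≫ l.hom = g := by
      rw [← hl, Adjunction.homEquiv_unit]; rfl
    have h1 : l.hom ≫ k = 𝟙 _ := by
      have : l ≫ k' = 𝟙 _ := by
        apply (adj.homEquiv Y _).injective
        rw [Adjunction.homEquiv_unit, Adjunction.homEquiv_unit]
        change u ≫ (l.hom ≫ k) = u ≫ 𝟙 _
        rw [← Category.assoc, hl', ← hk, Category.comp_id]
      exact congrArg (F.leN n).ι.map this
    have h2 : k ≫ l.hom = 𝟙 B := by
      have h0 : g ≫ (k ≫ l.hom - 𝟙 B) = 0 := by
        rw [Preadditive.comp_sub, Category.comp_id, ← Category.assoc, ← hk, hl', sub_self]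
      obtain ⟨m, hm⟩ := Triangle.yoneda_exact₃ _ hT _ h0
      have hm0 : m = 0 := F.homN_eq_zero n m ((F.geN (n + 1)).le_shift (1 : ℤ) _ hA) hB
      rw [hm0, comp_zero] at hm
      exact sub_eq_zero.1 hm
    let e : B ≅ ((F.σLE n).obj Y).obj :=
      { hom := k, inv := l.hom, hom_inv_id := h2, inv_hom_id := h1 }
    exact (F.geN n).prop_of_iso e hB'
  exact key _ ((F.σGE n).obj X).property

lemma core_pow_inverse_σ (F : FCategory C) (n : ℤ) (X : C) :
    F.core ((F.σ n ⋙ (F.s ^ n).inverse).obj X) := by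
  constructor
  · obtain ⟨Y, hY, ⟨e⟩⟩ := F.leN_σ n X
    exact F.le.prop_of_iso
      ((F.s ^ n).unitIso.app Y ≪≫ (F.s ^ n).inverse.mapIso e) hY
  · obtain ⟨Y, hY, ⟨e⟩⟩ := F.geN_σ n X
    exact F.ge.prop_of_iso
      ((F.s ^ n).unitIso.app Y ≪≫ (F.s ^ n).inverse.mapIso e) hY

end FCategory

/-- An f-category over the triangulated category `T`: an f-category structure on `C` together with
an equivalence `i` of triangulated categories from `T` to `C([0]) = C(≤ 0) ∩ C(≥ 0)`. -/
structure FCategoryOver (T : Type u₁) [Category.{v₁} T] [Preadditive T] [HasZeroObject T]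
    [HasShift T ℤ] [∀ n : ℤ, (shiftFunctor T n).Additive] [Pretriangulated T]
    (C : Type u₂) [Category.{v₂} C] [Preadditive C] [HasZeroObject C]
    [HasShift C ℤ] [∀ n : ℤ, (shiftFunctor C n).Additive] [Pretriangulated C]
    extends FCategory C where
  /-- the equivalence from `T` to `C([0])` -/
  i : T ⥤ toFCategory.core.FullSubcategory
  i_isEquivalence : i.IsEquivalence
  iCommShift : i.CommShift ℤ
  i_isTriangulated : i.IsTriangulated

namespace FCategoryOver

attribute [instance] i_isEquivalence iCommShift i_isTriangulated

variable {T : Type u₁} [Category.{v₁} T] [Preadditive T] [HasZeroObject T]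
  [HasShift T ℤ] [∀ n : ℤ, (shiftFunctor T n).Additive] [Pretriangulated T]
  {C : Type u₂} [Category.{v₂} C] [Preadditive C] [HasZeroObject C]
  [HasShift C ℤ] [∀ n : ℤ, (shiftFunctor C n).Additive] [Pretriangulated C]

/-- The graded piece functor `gr^n = i⁻¹ s^{-n} σ_n : C ⥤ T`, with `i⁻¹` a fixed quasi-inverse
of `i`. -/
noncomputable def gr (F : FCategoryOver T C) (n : ℤ) : C ⥤ T :=
  F.core.lift (F.σ n ⋙ (F.s ^ n).inverse) (F.core_pow_inverse_σ n) ⋙ F.i.inv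

/-- A weight structure `w'` on `C` is compatible with a weight structure `w` on `T` if the functor
`i : T ⥤ C` is w-exact and `s(C^{w' ≤ 0}) = C^{w' ≤ 1}`. -/
def Compatible (F : FCategoryOver T C) (w : WeightStructure T) (w' : WeightStructure C) : Prop :=
  WExact w w' (F.i ⋙ F.core.ι) ∧ w'.le.map F.s.functor = w'.leN 1

end FCategoryOver

/-!
An f-category has a finite filtration on every object `X`, whose graded pieces are the objects
`σ_n X ≅ s^n (i (gr^n X))`. Hence a class of objects that is closed under extensions contains `X` as
soon as it contains these pieces (`FCategoryOver.devissage`). The functors `gr^n` are triangulated,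
as composites of adjoints of triangulated functors, and `gr^n` applied to `s^m (i M)` is `M` for
`n = m` and zero otherwise; so conditions on graded pieces define extension-closed classes that are
easily tested on objects concentrated in one filtration degree.

*Existence.* Let `grLE` and `grGE` be the two classes defined by the conditions on graded pieces. By
dévissage, orthogonality reduces to maps from `s^a (i M)` to `s^b (i N)`
(`FCategoryOver.hom_single_eq_zero`). They vanish by an axiom if `a > b`; if `a ≤ b`, composition
with `α` identifies them with maps from `M` to `N`, which vanish for reasons of weight because the
weight bound `-b` on `N` is at most the bound `-a`. Weight decompositions exist in a single degree,
where they come from `T`. In a triangulated category the class of objects admitting a decomposition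
is closed under extensions, by associativity of the extension product and because extensions in the
wrong order split (`ObjectProperty.isTriangulatedClosed₂_extensionProduct`), so dévissage applies
again. Compatibility follows from `gr^{n+1} (s X) ≅ gr^n X`.

*Uniqueness.* In a weight structure each half is the orthogonal of the other; hence both halves are
closed under extensions, and nested weight structures are equal (`WeightStructure.eq_of_le`). If
`w'` is compatible with `w`, then `s` also carries the non-negative half to its shift, so `w'`
contains all `s^n (i M)` with `M` of the appropriate weight, and by dévissage `grLE` and `grGE`.
Thus `w'` is the filtered weight structure, which also gives the explicit formulas.
-/

/-! ### Extension-closed classes of objects -/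

namespace CategoryTheory.ObjectProperty

variable {C : Type u₁} [Category.{v₁} C] [Preadditive C] [HasZeroObject C]
  [HasShift C ℤ] [∀ n : ℤ, (shiftFunctor C n).Additive] [Pretriangulated C]

lemma isClosedUnderBinaryProducts_of_isTriangulatedClosed₂ (P : ObjectProperty C)
    [P.IsTriangulatedClosed₂] [P.IsClosedUnderIsomorphisms] :
    P.IsClosedUnderBinaryProducts where
  limitsOfShape_le := by
    rintro X ⟨p⟩
    refine P.prop_of_iso ?_ (P.ext_of_isTriangulatedClosed₂ _
      (binaryProductTriangle_distinguished _ _)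
      (p.prop_diag_obj (.mk .left)) (p.prop_diag_obj (.mk .right)))
    exact IsLimit.conePointUniqueUpToIso (prodIsProd _ _)
      ((IsLimit.postcomposeHomEquiv (diagramIsoPair p.diag) _).2 p.isLimit)

instance isTriangulatedClosed₂_shift (P : ObjectProperty C) [P.IsTriangulatedClosed₂]
    [P.IsClosedUnderIsomorphisms] (n : ℤ) : (P.shift n).IsTriangulatedClosed₂ :=
  .mk' (fun T hT h₁ h₃ => P.ext_of_isTriangulatedClosed₂ _ (T.shift_distinguished hT n) h₁ h₃)

instance isStableUnderRetracts_shift (P : ObjectProperty C) [P.IsStableUnderRetracts] (n : ℤ) :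
    (P.shift n).IsStableUnderRetracts where
  of_retract r h := P.prop_of_retract (r.map (shiftFunctor C n)) h

instance containsZero_shift (P : ObjectProperty C) [P.ContainsZero]
    [P.IsClosedUnderIsomorphisms] (n : ℤ) : (P.shift n).ContainsZero where
  exists_zero := by
    obtain ⟨Z, hZ, hZ'⟩ := P.exists_prop_of_containsZero
    exact ⟨Z, hZ, P.prop_of_isZero ((shiftFunctor C n).map_isZero hZ)⟩

/-- If all maps from `P` to the shift of `Q` vanish, then extensions of `P` by `Q` split, hence
they are also extensions of `Q` by `P`. -/
lemma extensionProduct_le_swap {P Q : ObjectProperty C}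
    (h : ∀ ⦃X Y : C⦄ (f : X ⟶ Y⟦(1 : ℤ)⟧), P X → Q Y → f = 0) :
    extensionProduct Q P ≤ extensionProduct P Q := by
  rintro Z ⟨B, A, f, g, k, hT, hB, hA⟩
  obtain ⟨e, -, -⟩ := exists_iso_binaryBiproduct_of_distTriang _ hT (h k hA hB)
  exact (extensionProduct P Q).prop_of_iso (biprod.braiding A B ≪≫ e.symm)
    ⟨A, B, _, _, _, binaryBiproductTriangle_distinguished A B, hA, hB⟩

/-- If `P` and `Q` are closed under extensions and there are no maps from `P` to the shift of `Q`,
then the class of extensions of `Q` by `P` is closed under extensions. -/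
lemma isTriangulatedClosed₂_extensionProduct [CategoryTheory.IsTriangulated C]
    {P Q : ObjectProperty C} [P.IsTriangulatedClosed₂] [P.IsClosedUnderIsomorphisms]
    [Q.IsTriangulatedClosed₂] [Q.IsClosedUnderIsomorphisms]
    (h : ∀ ⦃X Y : C⦄ (f : X ⟶ Y⟦(1 : ℤ)⟧), P X → Q Y → f = 0) :
    (extensionProduct P Q).IsTriangulatedClosed₂ := by
  refine .mk' fun T hT h₁ h₃ => ?_
  have h₂ : extensionProduct (extensionProduct P Q) (extensionProduct P Q) T.obj₂ :=
    ⟨_, _, _, _, _, hT, h₁, h₃⟩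
  -- With `*` the extension product, `(P * Q) * (P * Q) = P * (Q * P) * Q ≤ (P * P) * (Q * Q)`.
  rw [extensionProduct_assoc, ← extensionProduct_assoc Q P Q] at h₂
  replace h₂ := monotone_extensionProduct_right P
    (monotone_extensionProduct_left Q (extensionProduct_le_swap h)) _ h₂
  rw [extensionProduct_assoc, ← extensionProduct_assoc P P] at h₂
  exact monotone_extensionProduct_right P
    (extensionProduct_le_of_isTriangulatedClosed₂ le_rfl le_rfl) _
    (monotone_extensionProduct_left _
      (extensionProduct_le_of_isTriangulatedClosed₂ le_rfl le_rfl) _ h₂)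

end CategoryTheory.ObjectProperty

/-! ### Weight structures and orthogonality -/

namespace WeightStructure

variable {C : Type u₁} [Category.{v₁} C] [Preadditive C] [HasZeroObject C]
  [HasShift C ℤ] [∀ n : ℤ, (shiftFunctor C n).Additive] [Pretriangulated C]
  (w : WeightStructure C)

attribute [instance] le_stableUnderRetracts ge_stableUnderRetracts le_containsZero
  ge_containsZero

instance (n : ℤ) : (w.leN n).IsStableUnderRetracts :=
  inferInstanceAs (w.le.shift n).IsStableUnderRetracts

instance (n : ℤ) : (w.geN n).IsStableUnderRetracts :=
  inferInstanceAs (w.ge.shift n).IsStableUnderRetracts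

instance (n : ℤ) : (w.leN n).ContainsZero :=
  inferInstanceAs (w.le.shift n).ContainsZero

instance (n : ℤ) : (w.geN n).ContainsZero :=
  inferInstanceAs (w.ge.shift n).ContainsZero

lemma leN_shift_iff (a b c : ℤ) (h : a + b = c) (X : C) : w.leN b (X⟦a⟧) ↔ w.leN c X := by
  rw [leN, leN, ← w.le.shift_shift a b c h]
  rfl

lemma geN_shift_iff (a b c : ℤ) (h : a + b = c) (X : C) : w.geN b (X⟦a⟧) ↔ w.geN c X := by
  rw [geN, geN, ← w.ge.shift_shift a b c h]
  rfl

lemma leN_zero : w.leN 0 = w.le := w.le.shift_zero ℤ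

lemma geN_zero : w.geN 0 = w.ge := w.ge.shift_zero ℤ

lemma leN_le_succ (n : ℤ) : w.leN n ≤ w.leN (n + 1) := fun X hX =>
  (w.leN_shift_iff n 1 (n + 1) rfl X).1 (w.le_zero_le_one _ hX)

lemma geN_succ_le (n : ℤ) : w.geN (n + 1) ≤ w.geN n := fun X hX =>
  w.ge_one_le_zero _ ((w.geN_shift_iff n 1 (n + 1) rfl X).2 hX)

lemma leN_mono : Monotone w.leN := monotone_int_of_le_succ w.leN_le_succ

lemma geN_anti : Antitone w.geN := antitone_int_of_succ_le w.geN_succ_le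

/-- The orthogonality `Hom(C^{w ≥ 1}, C^{w ≤ 0}) = 0` characterizes `C^{w ≤ 0}`: an object in the
right orthogonal of `C^{w ≥ 1}` is a retract of the second term of its weight decomposition. -/
lemma le_iff (Y : C) : w.le Y ↔ ∀ ⦃X : C⦄ (f : X ⟶ Y), w.geN 1 X → f = 0 := by
  refine ⟨fun hY X f hX => w.hom_eq_zero f hX hY, fun h => ?_⟩
  obtain ⟨A, B, f, g, k, hT, hA, hB⟩ := w.exists_triangle Y
  obtain ⟨r, hr⟩ := Triangle.yoneda_exact₂ _ hT (𝟙 Y)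
    ((Category.comp_id f).trans (h f hA))
  exact w.le.prop_of_retract ⟨g, r, hr.symm⟩ hB

/-- Dually, `C^{w ≥ 1}` is the left orthogonal of `C^{w ≤ 0}`. -/
lemma geN_one_iff (X : C) : w.geN 1 X ↔ ∀ ⦃Y : C⦄ (f : X ⟶ Y), w.le Y → f = 0 := by
  refine ⟨fun hX Y f hY => w.hom_eq_zero f hX hY, fun h => ?_⟩
  obtain ⟨A, B, f, g, k, hT, hA, hB⟩ := w.exists_triangle X
  obtain ⟨i, hi⟩ := Triangle.coyoneda_exact₂ _ hT (𝟙 X)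
    ((Category.id_comp g).trans (h g hB))
  exact (w.geN 1).prop_of_retract ⟨i, f, hi.symm⟩ hA

lemma ge_iff (X : C) : w.ge X ↔ ∀ ⦃Y : C⦄ (f : X ⟶ Y⟦(1 : ℤ)⟧), w.le Y → f = 0 := by
  rw [← w.geN_zero, ← w.geN_shift_iff (-1) 1 0 (by simp), w.geN_one_iff]
  have key : ∀ Y : C, (∀ f : X⟦(-1 : ℤ)⟧ ⟶ Y, f = 0) ↔ ∀ f : X ⟶ Y⟦(1 : ℤ)⟧, f = 0 := by
    intro Y
    let adj := (shiftEquiv C (1 : ℤ)).symm.toAdjunction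
    have hadd : (shiftEquiv C (1 : ℤ)).symm.functor.Additive :=
      inferInstanceAs (shiftFunctor C (-1 : ℤ)).Additive
    let e := adj.homAddEquiv X Y
    exact ⟨fun h f => e.symm.injective ((h _).trans (h _).symm),
      fun h f => e.injective ((h _).trans (h _).symm)⟩
  exact ⟨fun h Y f hY => (key Y).1 (fun g => h g hY) f,
    fun h Y f hY => (key Y).2 (fun g => h g hY) f⟩

instance : w.le.IsTriangulatedClosed₂ := .mk' fun T hT h₁ h₃ => by
  rw [le_iff] at *
  intro X f hX
  obtain ⟨g, rfl⟩ := Triangle.coyoneda_exact₂ _ hT f (h₃ _ hX)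
  rw [h₁ g hX, zero_comp]

instance : w.ge.IsTriangulatedClosed₂ := .mk' fun T hT h₁ h₃ => by
  rw [ge_iff] at *
  intro Y f hY
  obtain ⟨g, rfl⟩ := Triangle.yoneda_exact₂ _ hT f (h₁ _ hY)
  rw [h₃ g hY, comp_zero]

instance (n : ℤ) : (w.leN n).IsTriangulatedClosed₂ :=
  inferInstanceAs (w.le.shift n).IsTriangulatedClosed₂

instance (n : ℤ) : (w.geN n).IsTriangulatedClosed₂ :=
  inferInstanceAs (w.ge.shift n).IsTriangulatedClosed₂

/-- Two nested weight structures are equal. -/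
lemma eq_of_le {w₁ w₂ : WeightStructure C} (hle : w₁.le ≤ w₂.le) (hge : w₁.ge ≤ w₂.ge) :
    w₁ = w₂ := by
  ext X
  · refine ⟨hle X, fun hX => (w₁.le_iff X).2 fun Y f hY => ?_⟩
    exact w₂.hom_eq_zero f (hge _ hY) hX
  · refine ⟨hge X, fun hX => (w₁.ge_iff X).2 fun Y f hY => ?_⟩
    exact (w₂.ge_iff X).1 hX f (hle _ hY)

/-- Weight decompositions at an arbitrary integer, obtained by shifting. -/
lemma extensionProduct_geN_leN (n : ℤ) (X : C) :
    ObjectProperty.extensionProduct (w.geN (n + 1)) (w.leN n) X := by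
  obtain ⟨A, B, f, g, h, hT, hA, hB⟩ := w.exists_triangle (X⟦n⟧)
  refine ObjectProperty.prop_of_iso _ ((shiftFunctorCompIsoId C n (-n) (by simp)).app X)
    ⟨_, _, _, _, _, Triangle.shift_distinguished _ hT (-n), ?_, ?_⟩
  · exact (w.geN_shift_iff (-n) (n + 1) 1 (by ring) A).2 hA
  · exact (w.leN_shift_iff (-n) n 0 (by ring) B).2 (by rwa [leN_zero])

end WeightStructure

/-! ### The shift of filtration -/

namespace FCategory

variable {C : Type u₁} [Category.{v₁} C] [Preadditive C] [HasZeroObject C]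
  [HasShift C ℤ] [∀ n : ℤ, (shiftFunctor C n).Additive] [Pretriangulated C]
  (F : FCategory C)

/-- Complement to `powIso`: the extra factor `e` can also be applied last. -/
lemma nonempty_pow_succ_iso {C : Type u₁} [Category.{v₁} C] (e : C ≌ C) (n : ℤ) :
    Nonempty ((e ^ (n + 1)).functor ≅ (e ^ n).functor ⋙ e.functor) := by
  induction n using Int.induction_on with
  | zero =>
    obtain ⟨i⟩ := powIso e 0
    exact ⟨i ≪≫ Functor.rightUnitor _ ≪≫ (Functor.leftUnitor _).symm⟩
  | succ n ih =>
    obtain ⟨i⟩ := ih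
    obtain ⟨j⟩ := powIso e ((n : ℤ) + 1)
    obtain ⟨k⟩ := powIso e (n : ℤ)
    exact ⟨j ≪≫ Functor.isoWhiskerLeft _ i ≪≫ (Functor.associator _ _ _).symm ≪≫
      Functor.isoWhiskerRight k.symm _⟩
  | pred n ih =>
    obtain ⟨i⟩ := ih
    obtain ⟨j⟩ := powIso e (-(n : ℤ))
    obtain ⟨k⟩ := powIso e (-(n : ℤ) - 1)
    rw [sub_add_cancel] at k ⊢
    let l : e.functor ⋙ (e ^ (-(n : ℤ))).functor ≅
        e.functor ⋙ (e ^ (-(n : ℤ) - 1)).functor ⋙ e.functor :=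
      j.symm ≪≫ i ≪≫ Functor.isoWhiskerRight k _ ≪≫ Functor.associator _ _ _
    exact ⟨(Functor.leftUnitor _).symm ≪≫ Functor.isoWhiskerRight e.counitIso.symm _ ≪≫
      Functor.associator _ _ _ ≪≫ Functor.isoWhiskerLeft e.inverse l ≪≫
      (Functor.associator _ _ _).symm ≪≫ Functor.isoWhiskerRight e.counitIso _ ≪≫
      Functor.leftUnitor _⟩

lemma powImage_succ_eq_map {C : Type u₁} [Category.{v₁} C] (e : C ≌ C) (P : ObjectProperty C)
    (n : ℤ) : powImage e P (n + 1) = (powImage e P n).map e.functor := by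
  obtain ⟨i⟩ := nonempty_pow_succ_iso e n
  ext Y
  constructor
  · rintro ⟨X, hX, ⟨f⟩⟩
    exact ⟨(e ^ n).functor.obj X, ⟨X, hX, ⟨Iso.refl _⟩⟩, ⟨(i.app X).symm ≪≫ f⟩⟩
  · rintro ⟨X, ⟨Z, hZ, ⟨g⟩⟩, ⟨f⟩⟩
    exact ⟨Z, hZ, ⟨i.app Z ≪≫ e.functor.mapIso g ≪≫ f⟩⟩

lemma powImage_zero {C : Type u₁} [Category.{v₁} C] (e : C ≌ C) (P : ObjectProperty C)
    [P.IsClosedUnderIsomorphisms] : powImage e P 0 = P := by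
  ext Y
  exact ⟨fun ⟨X, hX, ⟨f⟩⟩ => P.prop_of_iso f hX, fun hY => ⟨Y, hY, ⟨Iso.refl _⟩⟩⟩

lemma leN_succ_eq_map (n : ℤ) : F.leN (n + 1) = (F.leN n).map F.s.functor :=
  powImage_succ_eq_map F.s F.le n

lemma geN_succ_eq_map (n : ℤ) : F.geN (n + 1) = (F.geN n).map F.s.functor :=
  powImage_succ_eq_map F.s F.ge n

lemma leN_le_succ (n : ℤ) : F.leN n ≤ F.leN (n + 1) := by
  unfold leN
  rw [powImage_succ]
  exact ObjectProperty.map_monotone F.le_le_one _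

lemma leN_mono : Monotone F.leN := monotone_int_of_le_succ F.leN_le_succ

lemma geN_anti : Antitone F.geN := antitone_int_of_succ_le F.geN_succ_le

/-- For `n < m`, only zero objects lie in both `C(≤ n)` and `C(≥ m)`. -/
lemma isZero_of_leN_of_geN {n m : ℤ} (h : n < m) {X : C} (hle : F.leN n X) (hge : F.geN m X) :
    IsZero X :=
  (IsZero.iff_id_eq_zero X).2 (F.homN_eq_zero n _ (F.geN_anti h _ hge) hle)

/-- The bijectivity of composition with `α`, in the form needed for orthogonality: for `X` in
`C(≤ n)` and `Y` in `C(≥ n)`, all maps from `X` to `s(Y)` vanish if all maps from `X` to `Y` do. The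
axiom is the case `n = 0`, and the other cases are obtained from it by applying `s`. -/
lemma hom_s_eq_zero (n : ℤ) {X Y : C} (hX : F.leN n X) (hY : F.geN n Y)
    (h : ∀ f : X ⟶ Y, f = 0) (f : X ⟶ F.s.functor.obj Y) : f = 0 := by
  induction n using Int.induction_on generalizing X Y with
  | zero =>
    rw [leN, powImage_zero] at hX
    obtain ⟨g, rfl⟩ := (F.bijective_comp_α hX (Y := F.s.functor.obj Y) (by
      change F.geN 1 _
      rw [← zero_add (1 : ℤ), geN_succ_eq_map]
      exact ⟨Y, hY, ⟨Iso.refl _⟩⟩)).2 f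
    have hg : g = 0 := by
      rw [← cancel_mono (F.s.unitIso.inv.app Y), zero_comp]
      exact h _
    rw [hg]
    exact zero_comp
  | succ n ih =>
    rw [leN_succ_eq_map] at hX
    rw [geN_succ_eq_map] at hY
    obtain ⟨X', hX', ⟨a⟩⟩ := hX
    obtain ⟨Y', hY', ⟨b⟩⟩ := hY
    obtain ⟨g, hg⟩ := F.s.functor.map_surjective
      (a.hom ≫ f ≫ F.s.functor.map b.inv)
    have hg0 : g = 0 := by
      refine ih hX' hY' (fun k => F.s.functor.map_injective ?_) g
      rw [Functor.map_zero, ← cancel_mono b.hom, ← cancel_epi a.inv, h (_ ≫ _ ≫ _)]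
      simp
    rw [hg0, Functor.map_zero] at hg
    rw [← cancel_mono (F.s.functor.map b.inv), ← cancel_epi a.hom, ← hg]
    simp
  | pred n ih =>
    refine F.s.functor.map_injective ?_
    rw [Functor.map_zero]
    rw [← sub_add_cancel (-(n : ℤ)) 1, leN_succ_eq_map, geN_succ_eq_map] at ih
    refine ih ⟨X, hX, ⟨Iso.refl _⟩⟩ ⟨Y, hY, ⟨Iso.refl _⟩⟩ (fun k => ?_) _
    obtain ⟨k, rfl⟩ := F.s.functor.map_surjective k
    rw [h k, Functor.map_zero]

/-! ### Truncations -/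

/-- The truncations are triangulated, being adjoint to triangulated functors. -/
lemma σ_isTriangulated (n : ℤ) : ∃ _ : (F.σ n).CommShift ℤ, (F.σ n).IsTriangulated := by
  let := (F.σGEAdj n).rightAdjointCommShift ℤ
  have := (F.σGEAdj n).commShift_of_leftAdjoint ℤ
  have := (F.σGEAdj n).isTriangulated_rightAdjoint
  let := (F.σLEAdj n).leftAdjointCommShift ℤ
  have := (F.σLEAdj n).commShift_of_rightAdjoint ℤ
  have := (F.σLEAdj n).isTriangulated_leftAdjoint
  unfold σ
  exact ⟨inferInstance, inferInstance⟩

lemma isZero_σLE {n : ℤ} {X : C} (hX : F.geN (n + 1) X) : IsZero ((F.σLE n).obj X).obj := by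
  rw [IsZero.iff_id_eq_zero]
  refine congrArg InducedCategory.Hom.hom (a₁ := 𝟙 ((F.σLE n).obj X)) (a₂ := 0)
    (((F.σLEAdj n).homEquiv X _).injective ?_)
  exact (F.homN_eq_zero n _ hX ((F.σLE n).obj X).property).trans
    (F.homN_eq_zero n _ hX ((F.σLE n).obj X).property).symm

lemma isZero_σGE {n : ℤ} {X : C} (hX : F.leN n X) : IsZero ((F.σGE (n + 1)).obj X).obj := by
  rw [IsZero.iff_id_eq_zero]
  refine congrArg InducedCategory.Hom.hom (a₁ := 𝟙 ((F.σGE (n + 1)).obj X)) (a₂ := 0)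
    (((F.σGEAdj (n + 1)).homEquiv _ X).symm.injective ?_)
  exact (F.homN_eq_zero n _ ((F.σGE (n + 1)).obj X).property hX).trans
    (F.homN_eq_zero n _ ((F.σGE (n + 1)).obj X).property hX).symm

lemma nonempty_σGE_iso {n : ℤ} {X : C} (hX : F.geN n X) :
    Nonempty (((F.σGE n).obj X).obj ≅ X) :=
  ⟨(F.geN n).ι.mapIso (asIso ((F.σGEAdj n).unit.app ⟨X, hX⟩)).symm⟩

lemma nonempty_σLE_iso {n : ℤ} {X : C} (hX : F.leN n X) :
    Nonempty (((F.σLE n).obj X).obj ≅ X) :=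
  ⟨(F.leN n).ι.mapIso (asIso ((F.σLEAdj n).counit.app ⟨X, hX⟩))⟩

lemma isZero_σ_of_geN {n m : ℤ} (h : n < m) {X : C} (hX : F.geN m X) :
    IsZero ((F.σ n).obj X) := by
  obtain ⟨e⟩ := F.nonempty_σGE_iso (F.geN_anti h.le _ hX)
  exact (F.isZero_σLE (F.geN_anti h _ hX)).of_iso ((F.σLE n ⋙ (F.leN n).ι).mapIso e)

lemma isZero_σ_of_leN {n m : ℤ} (h : m < n) {X : C} (hX : F.leN m X) :
    IsZero ((F.σ n).obj X) := by
  have h₁ : IsZero ((F.σGE n).obj X).obj := by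
    have := F.isZero_σGE (F.leN_mono (Int.le_sub_one_of_lt h) _ hX)
    rwa [sub_add_cancel] at this
  exact F.isZero_σLE ((F.geN (n + 1)).prop_of_isZero h₁)

lemma nonempty_σ_iso {n : ℤ} {X : C} (hge : F.geN n X) (hle : F.leN n X) :
    Nonempty ((F.σ n).obj X ≅ X) := by
  obtain ⟨e⟩ := F.nonempty_σGE_iso hge
  obtain ⟨e'⟩ := F.nonempty_σLE_iso hle
  exact ⟨(F.σLE n ⋙ (F.leN n).ι).mapIso e ≪≫ e'⟩

end FCategory

namespace FCategoryOver

variable {T : Type u₁} [Category.{v₁} T] [Preadditive T] [HasZeroObject T]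
  [HasShift T ℤ] [∀ n : ℤ, (shiftFunctor T n).Additive] [Pretriangulated T]
  {C : Type u₂} [Category.{v₂} C] [Preadditive C] [HasZeroObject C]
  [HasShift C ℤ] [∀ n : ℤ, (shiftFunctor C n).Additive] [Pretriangulated C]
  (F : FCategoryOver T C)

/-! ### Objects concentrated in one filtration degree -/

/-- The functor `s^n ∘ i : T ⥤ C`, an equivalence onto the objects of `C` concentrated in
filtration degree `n`. -/
def single (n : ℤ) : T ⥤ C := (F.i ⋙ F.core.ι) ⋙ (F.s ^ n).functor

instance (n : ℤ) : (F.single n).Full := by unfold single; infer_instance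

instance (n : ℤ) : (F.single n).Faithful := by unfold single; infer_instance

lemma single_isTriangulated (n : ℤ) :
    ∃ _ : (F.single n).CommShift ℤ, (F.single n).IsTriangulated := by
  obtain ⟨_, _⟩ := F.pow_isTriangulated n
  unfold single
  exact ⟨inferInstance, inferInstance⟩

lemma leN_single (n : ℤ) (M : T) : F.leN n ((F.single n).obj M) :=
  ⟨_, (F.i.obj M).property.1, ⟨Iso.refl _⟩⟩

lemma geN_single (n : ℤ) (M : T) : F.geN n ((F.single n).obj M) :=
  ⟨_, (F.i.obj M).property.2, ⟨Iso.refl _⟩⟩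

lemma nonempty_single_succ_iso (n : ℤ) (M : T) :
    Nonempty ((F.single (n + 1)).obj M ≅ F.s.functor.obj ((F.single n).obj M)) := by
  obtain ⟨e⟩ := FCategory.nonempty_pow_succ_iso F.s n
  exact ⟨e.app _⟩

lemma nonempty_single_shift_iso (n k : ℤ) (M : T) :
    Nonempty ((F.single n).obj (M⟦k⟧) ≅ ((F.single n).obj M)⟦k⟧) := by
  obtain ⟨_, _⟩ := F.single_isTriangulated n
  exact ⟨((F.single n).commShiftIso k).app M⟩

/-! ### Graded pieces -/

lemma gr_isTriangulated (n : ℤ) : ∃ _ : (F.gr n).CommShift ℤ, (F.gr n).IsTriangulated := by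
  obtain ⟨_, _⟩ := F.pow_isTriangulated n
  obtain ⟨_, _⟩ := F.σ_isTriangulated n
  let := (F.s ^ n).toAdjunction.rightAdjointCommShift ℤ
  have := (F.s ^ n).toAdjunction.commShift_of_leftAdjoint ℤ
  have := (F.s ^ n).toAdjunction.isTriangulated_rightAdjoint
  let adj : F.i ⊣ F.i.inv := F.i.asEquivalence.toAdjunction
  let := adj.rightAdjointCommShift ℤ
  have := adj.commShift_of_leftAdjoint ℤ
  have := adj.isTriangulated_rightAdjoint
  unfold gr
  exact ⟨inferInstance, inferInstance⟩

lemma nonempty_gr_shift_iso (n k : ℤ) (X : C) :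
    Nonempty ((F.gr n).obj (X⟦k⟧) ≅ ((F.gr n).obj X)⟦k⟧) := by
  obtain ⟨_, _⟩ := F.gr_isTriangulated n
  exact ⟨((F.gr n).commShiftIso k).app X⟩

/-- The graded piece `gr^n X` corresponds to `σ_n X` under `s^n ∘ i`. -/
lemma nonempty_single_gr_iso (n : ℤ) (X : C) :
    Nonempty ((F.single n).obj ((F.gr n).obj X) ≅ (F.σ n).obj X) :=
  ⟨(F.s ^ n).functor.mapIso (F.core.ι.mapIso (F.i.asEquivalence.counitIso.app
    ((F.core.lift (F.σ n ⋙ (F.s ^ n).inverse) (F.core_pow_inverse_σ n)).obj X))) ≪≫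
    (F.s ^ n).counitIso.app _⟩

lemma isZero_gr_of_isZero_σ {n : ℤ} {X : C} (hX : IsZero ((F.σ n).obj X)) :
    IsZero ((F.gr n).obj X) := by
  obtain ⟨e⟩ := F.nonempty_single_gr_iso n X
  obtain ⟨_, _⟩ := F.single_isTriangulated n
  rw [IsZero.iff_id_eq_zero]
  exact (F.single n).map_injective ((hX.of_iso e).eq_of_src _ _)

lemma isZero_gr_of_geN {n m : ℤ} (h : n < m) {X : C} (hX : F.geN m X) :
    IsZero ((F.gr n).obj X) :=
  F.isZero_gr_of_isZero_σ (F.isZero_σ_of_geN h hX)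

lemma isZero_gr_of_leN {n m : ℤ} (h : m < n) {X : C} (hX : F.leN m X) :
    IsZero ((F.gr n).obj X) :=
  F.isZero_gr_of_isZero_σ (F.isZero_σ_of_leN h hX)

lemma isZero_gr_single {n m : ℤ} (h : n ≠ m) (M : T) :
    IsZero ((F.gr n).obj ((F.single m).obj M)) := by
  rcases h.lt_or_gt with h | h
  · exact F.isZero_gr_of_geN h (F.geN_single m M)
  · exact F.isZero_gr_of_leN h (F.leN_single m M)

lemma nonempty_single_gr_iso_self {n : ℤ} {X : C} (hge : F.geN n X) (hle : F.leN n X) :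
    Nonempty ((F.single n).obj ((F.gr n).obj X) ≅ X) := by
  obtain ⟨e⟩ := F.nonempty_single_gr_iso n X
  obtain ⟨e'⟩ := F.nonempty_σ_iso hge hle
  exact ⟨e ≪≫ e'⟩

lemma nonempty_gr_single_iso (n : ℤ) (M : T) :
    Nonempty ((F.gr n).obj ((F.single n).obj M) ≅ M) := by
  obtain ⟨e⟩ := F.nonempty_single_gr_iso_self (F.geN_single n M) (F.leN_single n M)
  exact ⟨(F.single n).preimageIso e⟩

lemma nonempty_gr_iso_of_isZero₃ {S : Triangle C} (hS : S ∈ distTriang C) {n : ℤ}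
    (h : IsZero ((F.gr n).obj S.obj₃)) : Nonempty ((F.gr n).obj S.obj₁ ≅ (F.gr n).obj S.obj₂) := by
  obtain ⟨_, _⟩ := F.gr_isTriangulated n
  have : IsIso ((F.gr n).map S.mor₁) :=
    (Triangle.isZero₃_iff_isIso₁ _ ((F.gr n).map_distinguished _ hS)).1 h
  exact ⟨asIso ((F.gr n).map S.mor₁)⟩

lemma nonempty_gr_iso_of_isZero₁ {S : Triangle C} (hS : S ∈ distTriang C) {n : ℤ}
    (h : IsZero ((F.gr n).obj S.obj₁)) : Nonempty ((F.gr n).obj S.obj₂ ≅ (F.gr n).obj S.obj₃) := by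
  obtain ⟨_, _⟩ := F.gr_isTriangulated n
  have : IsIso ((F.gr n).map S.mor₂) :=
    (Triangle.isZero₁_iff_isIso₂ _ ((F.gr n).map_distinguished _ hS)).1 h
  exact ⟨asIso ((F.gr n).map S.mor₂)⟩

lemma leN_s {n : ℤ} {X : C} (hX : F.leN n X) : F.leN (n + 1) (F.s.functor.obj X) := by
  rw [F.leN_succ_eq_map]
  exact ⟨X, hX, ⟨Iso.refl _⟩⟩

lemma geN_s {n : ℤ} {X : C} (hX : F.geN n X) : F.geN (n + 1) (F.s.functor.obj X) := by
  rw [F.geN_succ_eq_map]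
  exact ⟨X, hX, ⟨Iso.refl _⟩⟩

/-- The shift of filtration shifts the index of graded pieces: `gr^{n+1} (s X) ≅ gr^n X`. -/
lemma nonempty_gr_s_iso (n : ℤ) (X : C) :
    Nonempty ((F.gr (n + 1)).obj (F.s.functor.obj X) ≅ (F.gr n).obj X) := by
  -- Two truncation triangles replace `X` by an object `Z` concentrated in degree `n`.
  obtain ⟨A, B, f, g, h, hT, hA, hB⟩ := F.exists_triangleN (n - 1) X
  obtain ⟨A', Z, f', g', h', hT', hA', hZ⟩ := F.exists_triangleN n A
  rw [sub_add_cancel] at hA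
  have hZ' : F.geN n Z := (F.geN n).ext_of_isTriangulatedClosed₃ _ hT' (F.geN_succ_le n _ hA') hA
  have hsB := F.leN_s hB
  rw [sub_add_cancel] at hsB
  obtain ⟨e₁⟩ := F.nonempty_gr_iso_of_isZero₃ hT (F.isZero_gr_of_leN (n := n) (by simp) hB)
  obtain ⟨e₂⟩ := F.nonempty_gr_iso_of_isZero₁ hT' (F.isZero_gr_of_geN (lt_add_one n) hA')
  obtain ⟨e₃⟩ := F.nonempty_gr_iso_of_isZero₃ (F.s.functor.map_distinguished _ hT)
    (F.isZero_gr_of_leN (n := n + 1) (by simp) hsB)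
  obtain ⟨e₄⟩ := F.nonempty_gr_iso_of_isZero₁ (F.s.functor.map_distinguished _ hT')
    (F.isZero_gr_of_geN (n := n + 1) (by simp) (F.geN_s hA'))
  obtain ⟨e₅⟩ := F.nonempty_single_gr_iso_self hZ' hZ
  obtain ⟨e₆⟩ := F.nonempty_single_succ_iso n ((F.gr n).obj Z)
  obtain ⟨e₇⟩ := F.nonempty_gr_single_iso (n + 1) ((F.gr n).obj Z)
  exact ⟨e₃.symm ≪≫ e₄ ≪≫ (F.gr (n + 1)).mapIso (F.s.functor.mapIso e₅.symm ≪≫ e₆.symm) ≪≫ e₇ ≪≫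
    e₂.symm ≪≫ e₁⟩

/-- Dévissage along the filtration: a class of objects closed under extensions contains `X` as soon
as it contains all the objects `s^n (i (gr^n X)) ≅ σ_n X`. -/
lemma devissage (P : ObjectProperty C) [P.IsClosedUnderIsomorphisms] [P.ContainsZero]
    [P.IsTriangulatedClosed₂] (X : C) (h : ∀ n, P ((F.single n).obj ((F.gr n).obj X))) :
    P X := by
  suffices ∀ (k : ℕ) (m : ℤ) (X : C), F.geN m X → F.leN (m + k - 1) X →
      (∀ n, P ((F.single n).obj ((F.gr n).obj X))) → P X by
    obtain ⟨b, hb⟩ := F.exists_le X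
    obtain ⟨a, ha⟩ := F.exists_ge X
    exact this (b + 1 - a).toNat a X ha (F.leN_mono (by omega) _ hb) h
  intro k
  induction k with
  | zero =>
    intro m X hge hle _
    exact P.prop_of_isZero (F.isZero_of_leN_of_geN (by simp) hle hge)
  | succ k ih =>
    intro m X hge hle h
    -- Split off the lowest graded piece `B` of `X`: `A` has the same graded pieces as `X` in degrees
    -- above `m`, and is spread over one degree less.
    obtain ⟨A, B, f, g, δ, hT, hA, hB⟩ := F.exists_triangleN m X
    have hB' : F.geN m B :=
      (F.geN m).ext_of_isTriangulatedClosed₃ _ hT (F.geN_succ_le m _ hA) hge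
    have hA' : F.leN (m + 1 + k - 1) A := by
      refine (F.leN _).ext_of_isTriangulatedClosed₁ _ hT (F.leN_mono ?_ _ hle)
        (F.leN_mono ?_ _ hB) <;> push_cast <;> omega
    refine P.ext_of_isTriangulatedClosed₂ _ hT (ih (m + 1) A hA hA' fun n => ?_) ?_
    · rcases lt_or_ge m n with hn | hn
      · obtain ⟨e⟩ := F.nonempty_gr_iso_of_isZero₃ hT (F.isZero_gr_of_leN hn hB)
        exact P.prop_of_iso ((F.single n).mapIso e.symm) (h n)
      · obtain ⟨_, _⟩ := F.single_isTriangulated n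
        exact P.prop_of_isZero
          ((F.single n).map_isZero (F.isZero_gr_of_geN (Int.lt_add_one_of_le hn) hA))
    · obtain ⟨e⟩ := F.nonempty_gr_iso_of_isZero₁ hT (F.isZero_gr_of_geN (lt_add_one m) hA)
      obtain ⟨e'⟩ := F.nonempty_single_gr_iso_self hB' hB
      exact P.prop_of_iso ((F.single m).mapIso e ≪≫ e') (h m)

variable (w : WeightStructure T)

/-! ### Conditions on all graded pieces -/

/-- The objects `X` of `C` such that `gr^j X` satisfies `P j` for all `j`. -/
def grProp (P : ℤ → ObjectProperty T) : ObjectProperty C := fun X => ∀ j, P j ((F.gr j).obj X)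

section

variable (P : ℤ → ObjectProperty T)

instance [∀ j, (P j).IsStableUnderRetracts] : (F.grProp P).IsStableUnderRetracts where
  of_retract r h j := (P j).prop_of_retract (r.map (F.gr j)) (h j)

instance [∀ j, (P j).ContainsZero] [∀ j, (P j).IsClosedUnderIsomorphisms] :
    (F.grProp P).ContainsZero where
  exists_zero := by
    refine ⟨_, isZero_zero C, fun j => ?_⟩
    obtain ⟨_, _⟩ := F.gr_isTriangulated j
    exact (P j).prop_of_isZero ((F.gr j).map_isZero (isZero_zero C))

instance [∀ j, (P j).IsTriangulatedClosed₂] [∀ j, (P j).IsStableUnderRetracts] :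
    (F.grProp P).IsTriangulatedClosed₂ := .mk' fun X hX h₁ h₃ j => by
  obtain ⟨_, _⟩ := F.gr_isTriangulated j
  exact (P j).ext_of_isTriangulatedClosed₂ _ ((F.gr j).map_distinguished _ hX) (h₁ j) (h₃ j)

lemma grProp_single_iff [∀ j, (P j).ContainsZero] [∀ j, (P j).IsClosedUnderIsomorphisms]
    (n : ℤ) (M : T) : F.grProp P ((F.single n).obj M) ↔ P n M := by
  obtain ⟨e⟩ := F.nonempty_gr_single_iso n M
  refine ⟨fun h => (P n).prop_of_iso e (h n), fun h j => ?_⟩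
  rcases eq_or_ne j n with rfl | hj
  · exact (P j).prop_of_iso e.symm h
  · exact (P j).prop_of_isZero (F.isZero_gr_single hj M)

lemma grProp_shift [∀ j, (P j).IsClosedUnderIsomorphisms] (k : ℤ) :
    (F.grProp P).shift k = F.grProp fun j => (P j).shift k := by
  ext X
  refine forall_congr' fun j => ?_
  obtain ⟨e⟩ := F.nonempty_gr_shift_iso j k X
  exact (P j).prop_iff_of_iso e

end

/-- The subcategory `{X | gr^j X ∈ T^{w ≤ -j} for all j}`. -/
def grLE : ObjectProperty C := F.grProp fun j => w.leN (-j)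

/-- The subcategory `{X | gr^j X ∈ T^{w ≥ -j} for all j}`. -/
def grGE : ObjectProperty C := F.grProp fun j => w.geN (-j)

instance : (F.grLE w).IsStableUnderRetracts := by unfold grLE; infer_instance

instance : (F.grGE w).IsStableUnderRetracts := by unfold grGE; infer_instance

instance : (F.grLE w).ContainsZero := by unfold grLE; infer_instance

instance : (F.grGE w).ContainsZero := by unfold grGE; infer_instance

instance : (F.grLE w).IsTriangulatedClosed₂ := by unfold grLE; infer_instance

instance : (F.grGE w).IsTriangulatedClosed₂ := by unfold grGE; infer_instance

lemma grLE_shift (k : ℤ) : (F.grLE w).shift k = F.grProp fun j => w.leN (k - j) := by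
  rw [grLE, grProp_shift]
  congr 1
  ext j
  exact w.leN_shift_iff k (-j) (k - j) (by ring) _

lemma grGE_shift (k : ℤ) : (F.grGE w).shift k = F.grProp fun j => w.geN (k - j) := by
  rw [grGE, grProp_shift]
  congr 1
  ext j
  exact w.geN_shift_iff k (-j) (k - j) (by ring) _

/-! ### Orthogonality -/

/-- Orthogonality between objects concentrated in single filtration degrees `a` and `b`. For
`a > b` this is an axiom of f-categories. For `a ≤ b` all maps vanish because all maps `M ⟶ N` do:
the degree of the target is raised from `a` to `b` by means of `α`. -/
lemma hom_single_eq_zero {a b : ℤ} {M N : T} (hM : w.geN (1 - a) M) (hN : w.leN (-b) N)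
    (f : (F.single a).obj M ⟶ (F.single b).obj N) : f = 0 := by
  rcases lt_or_ge b a with hab | hab
  · exact F.homN_eq_zero b f (F.geN_anti (Int.add_one_le_of_lt hab) _ (F.geN_single a M))
      (F.leN_single b N)
  have hMN (g : M ⟶ N) : g = 0 := by
    have := (w.le_iff (N⟦-a⟧)).1
      (by
        rw [← w.leN_zero, w.leN_shift_iff (-a) 0 (-a) (by simp)]
        exact w.leN_mono (by omega) _ hN)
      (g⟦-a⟧') ((w.geN_shift_iff (-a) 1 (1 - a) (by ring) M).2 hM)
    exact (shiftFunctor T (-a)).map_injective (this.trans (Functor.map_zero _ _ _).symm)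
  induction b, hab using Int.leInduction with
  | base =>
    obtain ⟨_, _⟩ := F.single_isTriangulated a
    obtain ⟨g, rfl⟩ := (F.single a).map_surjective f
    rw [hMN g, Functor.map_zero]
  | succ b hab ih =>
    obtain ⟨e⟩ := F.nonempty_single_succ_iso b N
    rw [← cancel_mono e.hom, zero_comp]
    exact F.hom_s_eq_zero b (F.leN_mono hab _ (F.leN_single a M)) (F.geN_single b N)
      (ih (w.leN_mono (by omega) _ hN)) _

/-- Orthogonality in general, by dévissage first in the source, then in the target. -/
lemma hom_eq_zero_of_grProp {X Y : C} (hX : (F.grGE w).shift (1 : ℤ) X) (hY : F.grLE w Y)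
    (f : X ⟶ Y) : f = 0 := by
  rw [grGE_shift] at hX
  let P : ObjectProperty C := fun X => ∀ (n : ℤ) (f : X ⟶ (F.single n).obj ((F.gr n).obj Y)), f = 0
  let Q : ObjectProperty C := fun Y => ∀ f : X ⟶ Y, f = 0
  have : P.IsClosedUnderIsomorphisms := ⟨fun e h n f => by
    rw [← cancel_epi e.hom, h n (e.hom ≫ f), comp_zero]⟩
  have : Q.IsClosedUnderIsomorphisms := ⟨fun e h f => by
    rw [← cancel_mono e.inv, h (f ≫ e.inv), zero_comp]⟩
  have : P.ContainsZero := ⟨_, isZero_zero C, fun n f => (isZero_zero C).eq_of_src _ _⟩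
  have : Q.ContainsZero := ⟨_, isZero_zero C, fun f => (isZero_zero C).eq_of_tgt _ _⟩
  have : P.IsTriangulatedClosed₂ := .mk' fun T hT h₁ h₃ n f => by
    obtain ⟨g, rfl⟩ := Triangle.yoneda_exact₂ _ hT f (h₁ n _)
    rw [h₃ n g, comp_zero]
  have : Q.IsTriangulatedClosed₂ := .mk' fun T hT h₁ h₃ f => by
    obtain ⟨g, rfl⟩ := Triangle.coyoneda_exact₂ _ hT f (h₃ _)
    rw [h₁ g, zero_comp]
  exact F.devissage Q Y (F.devissage P X fun m n g =>
    F.hom_single_eq_zero w (hX m) (hY n) g) f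

/-! ### Weight decompositions and the filtered weight structure -/

/-- Existence of weight decompositions: they exist for objects concentrated in one filtration degree,
and by orthogonality the objects having one are closed under extensions. -/
lemma extensionProduct_grGE_grLE [CategoryTheory.IsTriangulated C] (X : C) :
    ObjectProperty.extensionProduct ((F.grGE w).shift (1 : ℤ)) (F.grLE w) X := by
  have : (ObjectProperty.extensionProduct ((F.grGE w).shift (1 : ℤ))
      (F.grLE w)).IsTriangulatedClosed₂ :=
    ObjectProperty.isTriangulatedClosed₂_extensionProduct fun X Y f hX hY => by
      refine F.hom_eq_zero_of_grProp w hX (fun j => ?_) f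
      have : (F.grLE w).shift (-1 : ℤ) (Y⟦(1 : ℤ)⟧) :=
        (F.grLE w).prop_of_iso ((shiftFunctorCompIsoId C (1 : ℤ) (-1) (by simp)).symm.app Y) hY
      rw [grLE_shift] at this
      exact w.leN_mono (by omega) _ (this j)
  have : (ObjectProperty.extensionProduct ((F.grGE w).shift (1 : ℤ))
      (F.grLE w)).ContainsZero :=
    ⟨_, isZero_zero C, ObjectProperty.le_extensionProduct_left _ _ (ObjectProperty.prop_zero _)⟩
  refine F.devissage _ X fun n => ?_
  obtain ⟨A, B, f, g, h, hT, hA, hB⟩ := w.extensionProduct_geN_leN (-n) ((F.gr n).obj X)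
  obtain ⟨_, _⟩ := F.single_isTriangulated n
  refine ⟨_, _, _, _, _, (F.single n).map_distinguished _ hT, ?_, ?_⟩
  · rw [grGE_shift]
    refine (F.grProp_single_iff _ n A).2 ?_
    rwa [sub_eq_neg_add]
  · exact (F.grProp_single_iff _ n B).2 hB

/-- The weight structure on `C` defined by conditions on the graded pieces. -/
def filteredWeightStructure [CategoryTheory.IsTriangulated C] : WeightStructure C where
  le := F.grLE w
  ge := F.grGE w
  le_containsZero := inferInstance
  le_closedUnderBinaryProducts :=
    (F.grLE w).isClosedUnderBinaryProducts_of_isTriangulatedClosed₂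
  le_stableUnderRetracts := inferInstance
  ge_containsZero := inferInstance
  ge_closedUnderBinaryProducts :=
    (F.grGE w).isClosedUnderBinaryProducts_of_isTriangulatedClosed₂
  ge_stableUnderRetracts := inferInstance
  le_zero_le_one X hX := by
    rw [grLE_shift]
    exact fun j => w.leN_mono (by omega) _ (hX j)
  ge_one_le_zero X hX := by
    rw [grGE_shift] at hX
    exact fun j => w.geN_anti (by omega) _ (hX j)
  hom_eq_zero _ _ f hX hY := F.hom_eq_zero_of_grProp w hX hY f
  exists_triangle := F.extensionProduct_grGE_grLE w

/-! ### Compatibility -/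

lemma grLE_s_iff (X : C) :
    (F.grLE w).shift (1 : ℤ) (F.s.functor.obj X) ↔ F.grLE w X := by
  rw [grLE_shift]
  refine (Equiv.addRight (1 : ℤ)).forall_congr_right.symm.trans (forall_congr' fun j => ?_)
  obtain ⟨e⟩ := F.nonempty_gr_s_iso j X
  change w.leN (1 - (j + 1)) ((F.gr (j + 1)).obj _) ↔ w.leN (-j) _
  rw [(w.leN _).prop_iff_of_iso e, show (1 : ℤ) - (j + 1) = -j by ring]

/-- The compatibility condition `s(C^{w' ≤ 0}) = C^{w' ≤ 1}` on essential images, objectwise. -/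
lemma map_s_eq_leN_one_iff (w' : WeightStructure C) :
    w'.le.map F.s.functor = w'.leN 1 ↔ ∀ X, w'.leN 1 (F.s.functor.obj X) ↔ w'.le X := by
  constructor
  · refine fun h X => ⟨fun hX => ?_, fun hX => ?_⟩
    · rw [← h] at hX
      obtain ⟨Y, hY, ⟨e⟩⟩ := hX
      exact w'.le.prop_of_iso (F.s.functor.preimageIso e) hY
    · rw [← h]
      exact ⟨X, hX, ⟨Iso.refl _⟩⟩
  · intro h
    ext X
    constructor
    · rintro ⟨Y, hY, ⟨e⟩⟩
      exact (w'.leN 1).prop_of_iso e ((h Y).2 hY)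
    · intro hX
      let e := F.s.counitIso.app X
      exact ⟨F.s.inverse.obj X, (h _).1 ((w'.leN 1).prop_of_iso e.symm hX), ⟨e⟩⟩

lemma compatible_filteredWeightStructure [CategoryTheory.IsTriangulated C] :
    F.Compatible w (F.filteredWeightStructure w) := by
  refine ⟨⟨fun M hM => ?_, fun M hM => ?_⟩, (F.map_s_eq_leN_one_iff _).2 (F.grLE_s_iff w)⟩
  · refine (F.grProp_single_iff (fun j => w.leN (-j)) 0 M).2 ?_
    rwa [neg_zero, w.leN_zero]
  · refine (F.grProp_single_iff (fun j => w.geN (-j)) 0 M).2 ?_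
    rwa [neg_zero, w.geN_zero]

/-! ### Uniqueness -/

variable {w}

lemma Compatible.le_s_iff {F : FCategoryOver T C} {w' : WeightStructure C}
    (h : F.Compatible w w') (X : C) : w'.leN 1 (F.s.functor.obj X) ↔ w'.le X :=
  (F.map_s_eq_leN_one_iff w').1 h.2 X

/-- The non-negative half of a compatible weight structure behaves under `s` like the non-positive
half, since it is determined by orthogonality. -/
lemma Compatible.ge_s_iff {F : FCategoryOver T C} {w' : WeightStructure C}
    (h : F.Compatible w w') (X : C) : w'.geN 1 (F.s.functor.obj X) ↔ w'.ge X := by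
  rw [w'.geN_one_iff, w'.ge_iff]
  constructor
  · intro H Y f hY
    refine F.s.functor.map_injective ((H _ ?_).trans (Functor.map_zero _ _ _).symm)
    refine w'.le.prop_of_iso ((F.s.functor.commShiftIso (1 : ℤ)).symm.app Y) ?_
    exact (h.le_s_iff Y).2 hY
  · intro H Y f hY
    -- Write `Y` as `s(Z⟦1⟧)`.
    let Z : C := (F.s.inverse.obj Y)⟦(-1 : ℤ)⟧
    let e₁ : Z⟦(1 : ℤ)⟧ ≅ F.s.inverse.obj Y :=
      (shiftFunctorCompIsoId C (-1 : ℤ) 1 (by simp)).app _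
    let e : F.s.functor.obj (Z⟦(1 : ℤ)⟧) ≅ Y := F.s.functor.mapIso e₁ ≪≫ F.s.counitIso.app Y
    have hZ : w'.le Z := (h.le_s_iff Z).1
      (w'.le.prop_of_iso (e.symm ≪≫ (F.s.functor.commShiftIso (1 : ℤ)).app Z) hY)
    obtain ⟨g, hg⟩ := F.s.functor.map_surjective (f ≫ e.inv)
    rw [← cancel_mono e.inv, ← hg, H g hZ, Functor.map_zero, zero_comp]

/-- A class of objects containing `i(M)` and transported by `s` as in a compatible weight structure
contains all `s^n(i(M))[n]`. -/
lemma prop_single_shift {P : ObjectProperty C} [P.IsClosedUnderIsomorphisms]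
    (hP : ∀ X, P.shift (1 : ℤ) (F.s.functor.obj X) ↔ P X) {M : T}
    (hM : P ((F.i ⋙ F.core.ι).obj M)) (n : ℤ) : P (((F.single n).obj M)⟦n⟧) := by
  have step (n : ℤ) : P (((F.single (n + 1)).obj M)⟦n + 1⟧) ↔ P (((F.single n).obj M)⟦n⟧) := by
    obtain ⟨e⟩ := F.nonempty_single_succ_iso n M
    rw [← hP (((F.single n).obj M)⟦n⟧), ObjectProperty.prop_shift_iff]
    exact P.prop_iff_of_iso ((shiftFunctor C (n + 1)).mapIso e ≪≫
      (shiftFunctorAdd C n 1).app _ ≪≫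
      (shiftFunctor C (1 : ℤ)).mapIso ((F.s.functor.commShiftIso n).symm.app _))
  induction n using Int.induction_on with
  | zero => exact P.prop_of_iso ((shiftFunctorZero C ℤ).symm.app _) hM
  | succ n ih => exact (step n).2 ih
  | pred n ih =>
    refine (step _).1 ?_
    rwa [sub_add_cancel]

/-- The previous lemma for a whole class `Q` of objects of `T`, with the shift moved inside: if
`M[-n]` lies in `Q`, then `s^n(i(M)) ≅ s^n(i(M[-n]))[n]` lies in `P`. -/
lemma prop_single {P : ObjectProperty C} [P.IsClosedUnderIsomorphisms]
    (hP : ∀ X, P.shift (1 : ℤ) (F.s.functor.obj X) ↔ P X) {Q : ObjectProperty T}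
    (hQ : ∀ M, Q M → P ((F.i ⋙ F.core.ι).obj M)) (n : ℤ) {M : T} (hM : Q.shift (-n) M) :
    P ((F.single n).obj M) := by
  obtain ⟨e⟩ := F.nonempty_single_shift_iso n (-n) M
  exact P.prop_of_iso ((shiftFunctor C n).mapIso e ≪≫
    (shiftFunctorCompIsoId C (-n) n (by simp)).app _) (F.prop_single_shift hP (hQ _ hM) n)

/-- By dévissage, both halves of the filtered weight structure are contained in those of any
compatible weight structure, and nested weight structures are equal. -/
lemma Compatible.eq_filteredWeightStructure [CategoryTheory.IsTriangulated C]
    {F : FCategoryOver T C} {w' : WeightStructure C} (h : F.Compatible w w') :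
    w' = F.filteredWeightStructure w :=
  (WeightStructure.eq_of_le (w₁ := F.filteredWeightStructure w)
    (fun X hX => F.devissage w'.le X fun n => F.prop_single h.le_s_iff h.1.1 n (hX n))
    (fun X hX => F.devissage w'.ge X fun n => F.prop_single h.ge_s_iff h.1.2 n (hX n))).symm

end FCategoryOver

/-! ### Existence and uniqueness of the compatible weight structure -/

theorem proposition7p3
    {T : Type u₁} [Category.{v₁} T] [Preadditive T] [HasZeroObject T]
    [HasShift T ℤ] [∀ n : ℤ, (shiftFunctor T n).Additive] [Pretriangulated T]
    [CategoryTheory.IsTriangulated T]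
    {C : Type u₂} [Category.{v₂} C] [Preadditive C] [HasZeroObject C]
    [HasShift C ℤ] [∀ n : ℤ, (shiftFunctor C n).Additive] [Pretriangulated C]
    [CategoryTheory.IsTriangulated C]
    (F : FCategoryOver T C) (w : WeightStructure T) :
    (∃! w' : WeightStructure C, F.Compatible w w') ∧
    ∀ w' : WeightStructure C, F.Compatible w w' →
      (∀ X : C, w'.le X ↔ ∀ j : ℤ, w.leN (-j) ((F.gr j).obj X)) ∧
      (∀ X : C, w'.ge X ↔ ∀ j : ℤ, w.geN (-j) ((F.gr j).obj X)) := by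
  refine ⟨⟨F.filteredWeightStructure w, F.compatible_filteredWeightStructure w,
    fun w' h => h.eq_filteredWeightStructure⟩, fun w' h => ?_⟩
  obtain rfl := h.eq_filteredWeightStructure
  exact ⟨fun X => Iff.rfl, fun X => Iff.rfl⟩
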